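/- All vector lattices are real and Archimedean. A net $(x_\alpha)$ in a vector lattice $E$ converges uniformly to $x\in E$ if there is $e\in E_+$ such that for every $\varepsilon>0$ there is $\alpha_0$ with $|x_\alpha-x|\le\varepsilon e$ for all $\alpha\ge\alpha_0$; it is uniformly Cauchy if the net $(x_\alpha-x_\beta)_{(\alpha,\beta)}$ converges uniformly to $0$. $E$ is uniformly complete if every uniformly Cauchy net in $E$ converges uniformly in $E$. A sublattice of $E$ is a linear subspace closed under $\vee$ and $\wedge$; it is called uniformly complete if it is so as a vector lattice in its own right. For a vector lattice $X$ with order (Dedekind) completion $X^\delta$, the uniform completion $X^{\rm ru}$ is the intersection of all uniformly complete sublattices of $X^\delta$ that contain $X$. **Theorem.** Let $X$ be a sublattice of a uniformly complete vector lattice $Z$, and let $\widehat X$ be the intersection of all uniformly complete sublattices of $Z$ that contain $X$. Then there is a lattice isomorphism (a linear bijection preserving $\vee$ and $\wedge$) from $X^{\rm ru}$ onto $\widehat X$ that fixes every element of $X$. In this sense, $X^\delta$ may be replaced by any uniformly complete vector lattice $Z$ containing $X$ in the definition of $X^{\rm ru}$. -/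

import Mathlib

universe u

/-! ### Archimedean vector lattices, uniform convergence, uniform completeness -/

/-- A real vector lattice (the order of `E` is a lattice order compatible with the vector space
structure) with the Archimedean property: if `x ≤ y / n` for all `n ≥ 1`, then `x ≤ 0`. -/
class ArchimedeanVectorLattice (E : Type u) [AddCommGroup E] [Lattice E] [Module ℝ E] : Prop
    extends IsOrderedAddMonoid E, IsOrderedModule ℝ E where
  le_zero_of_nsmul_le : ∀ x y : E, (∀ n : ℕ, n • x ≤ y) → x ≤ 0

section Uniform

variable {E : Type u} [AddCommGroup E] [Lattice E] [Module ℝ E]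

/-- The net `x` converges to `l` uniformly relative to `e`. -/
def UniformlyConvergesRel {Λ : Type u} [Preorder Λ] (e : E) (x : Λ → E) (l : E) : Prop :=
  ∀ ε : ℝ, 0 < ε → ∃ α₀ : Λ, ∀ α : Λ, α₀ ≤ α → |x α - l| ≤ ε • e

/-- The net `x` converges to `l` (relatively) uniformly: some `e ≥ 0` in the space `E` itself is a
regulator of the convergence. -/
def UniformlyConverges {Λ : Type u} [Preorder Λ] (x : Λ → E) (l : E) : Prop :=
  ∃ e : E, 0 ≤ e ∧ UniformlyConvergesRel e x l

/-- The net `x` is uniformly Cauchy: the net of differences, indexed by `Λ × Λ`, converges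
uniformly to zero. -/
def UniformlyCauchy {Λ : Type u} [Preorder Λ] (x : Λ → E) : Prop :=
  UniformlyConverges (fun p : Λ × Λ => x p.1 - x p.2) 0

variable (E) in
/-- Every uniformly Cauchy net converges uniformly. -/
def UniformlyComplete : Prop :=
  ∀ (Λ : Type u) [Preorder Λ] [Nonempty Λ] [IsDirectedOrder Λ] (x : Λ → E),
    UniformlyCauchy x → ∃ l : E, UniformlyConverges x l

end Uniform

/-! ### Sublattices of a vector lattice -/

/-- A (vector) sublattice: a linear subspace closed under the lattice operations. -/
structure VectorSublattice (E : Type u) [AddCommGroup E] [Lattice E] [Module ℝ E]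
    extends Submodule ℝ E where
  sup_mem' : ∀ {a b : E}, a ∈ carrier → b ∈ carrier → a ⊔ b ∈ carrier
  inf_mem' : ∀ {a b : E}, a ∈ carrier → b ∈ carrier → a ⊓ b ∈ carrier

namespace VectorSublattice

variable {E : Type u} [AddCommGroup E] [Lattice E] [Module ℝ E]

instance : SetLike (VectorSublattice E) E where
  coe Y := Y.carrier
  coe_injective := by
    rintro ⟨Y, _, _⟩ ⟨Y', _, _⟩ h
    congr
    exact SetLike.coe_injective h

instance : AddSubgroupClass (VectorSublattice E) E where
  add_mem {Y} _ _ ha hb := Y.toSubmodule.add_mem ha hb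
  zero_mem Y := Y.toSubmodule.zero_mem
  neg_mem {Y} _ ha := Y.toSubmodule.neg_mem ha

instance : SMulMemClass (VectorSublattice E) ℝ E where
  smul_mem {Y} r _ ha := Y.toSubmodule.smul_mem r ha

/-- A sublattice with the lattice operations of the ambient space. -/
instance (Y : VectorSublattice E) : Lattice Y :=
  Subtype.lattice (fun _ _ ha hb => Y.sup_mem' ha hb) (fun _ _ ha hb => Y.inf_mem' ha hb)

/-- A sublattice of an Archimedean vector lattice is one in its own right. -/
instance [ArchimedeanVectorLattice E] (Y : VectorSublattice E) : ArchimedeanVectorLattice Y where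
  add_le_add_left a b h c := add_le_add_left (show (a : E) ≤ b from h) (c : E)
  smul_le_smul_of_nonneg_left _ hr a b h :=
    smul_le_smul_of_nonneg_left (β := E) (show (a : E) ≤ b from h) hr
  smul_le_smul_of_nonneg_right a ha _ _ h :=
    smul_le_smul_of_nonneg_right (β := E) h (show (0 : E) ≤ a from ha)
  le_zero_of_nsmul_le x y h :=
    ArchimedeanVectorLattice.le_zero_of_nsmul_le (x : E) (y : E) fun n => h n

/-- The intersection of all uniformly complete sublattices of `E` that contain `X`. Each
sublattice `Y` is regarded as a vector lattice in its own right, so regulators and limits are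
taken in `Y`. -/
def uniformlyCompleteHull (X : VectorSublattice E) : VectorSublattice E where
  carrier := {z | ∀ Y : VectorSublattice E, (∀ x ∈ X, x ∈ Y) → UniformlyComplete Y → z ∈ Y}
  add_mem' ha hb Y hY hc := add_mem (ha Y hY hc) (hb Y hY hc)
  zero_mem' Y _ _ := zero_mem Y
  smul_mem' r _ ha Y hY hc := SMulMemClass.smul_mem r (ha Y hY hc)
  sup_mem' ha hb Y hY hc := Y.sup_mem' (ha Y hY hc) (hb Y hY hc)
  inf_mem' ha hb Y hY hc := Y.inf_mem' (ha Y hY hc) (hb Y hY hc)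

end VectorSublattice

/-! ### The order (Dedekind) completion of an Archimedean vector lattice -/

/-- The order completion of `E`: the Dedekind cuts of `E` whose two halves are non-empty, ordered
by inclusion of left halves. -/
def OrderCompletion (E : Type u) [Lattice E] : Type u :=
  {A : DedekindCut E // A.left.Nonempty ∧ A.right.Nonempty}

namespace OrderCompletion

section Order

variable {E : Type u} [Lattice E]

/-- The left half of a cut. -/
def L (A : OrderCompletion E) : Set E := A.1.left

/-- The right half of a cut. -/
def R (A : OrderCompletion E) : Set E := A.1.right

theorem L_nonempty (A : OrderCompletion E) : A.L.Nonempty := A.2.1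

theorem R_nonempty (A : OrderCompletion E) : A.R.Nonempty := A.2.2

theorem mem_R {A : OrderCompletion E} {c : E} : c ∈ A.R ↔ ∀ a ∈ A.L, a ≤ c := by
  rw [R, ← DedekindCut.upperBounds_left]; rfl

theorem mem_L {A : OrderCompletion E} {a : E} : a ∈ A.L ↔ ∀ c ∈ A.R, a ≤ c := by
  rw [L, ← DedekindCut.lowerBounds_right]; rfl

theorem ext_R {A B : OrderCompletion E} (h : ∀ c, c ∈ A.R ↔ c ∈ B.R) : A = B :=
  Subtype.ext (DedekindCut.ext' (Set.ext h))

instance : Lattice (OrderCompletion E) :=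
  Subtype.lattice
    (fun A B hA hB => by
      refine ⟨hA.1.mono (Concept.extent_subset_extent_iff.2 le_sup_left), ?_⟩
      obtain ⟨a, ha⟩ := hA.2
      obtain ⟨b, hb⟩ := hB.2
      refine ⟨a ⊔ b, DedekindCut.le_principal_iff.1 (sup_le ?_ ?_)⟩
      · exact (DedekindCut.le_principal_iff.2 ha).trans (by simp)
      · exact (DedekindCut.le_principal_iff.2 hb).trans (by simp))
    (fun A B hA hB => by
      refine ⟨?_, hA.2.mono (Concept.intent_subset_intent_iff.2 inf_le_left)⟩
      obtain ⟨a, ha⟩ := hA.1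
      obtain ⟨b, hb⟩ := hB.1
      refine ⟨a ⊓ b, DedekindCut.principal_le_iff.1 (le_inf ?_ ?_)⟩
      · exact le_trans (by simp) (DedekindCut.principal_le_iff.2 ha)
      · exact le_trans (by simp) (DedekindCut.principal_le_iff.2 hb))

theorem le_iff_L {A B : OrderCompletion E} : A ≤ B ↔ ∀ a ∈ A.L, a ∈ B.L := Iff.rfl

theorem le_iff_R {A B : OrderCompletion E} : A ≤ B ↔ ∀ c ∈ B.R, c ∈ A.R :=
  (Concept.intent_subset_intent_iff (c := B.1) (d := A.1)).symm

/-- The cut generated by a non-empty set `S` that is bounded above: its right half is the set of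
upper bounds of `S`. -/
def cut (S : Set E) (h₁ : S.Nonempty) (h₂ : BddAbove S) : OrderCompletion E :=
  ⟨Concept.ofObjects (· ≤ ·) S,
    h₁.mono fun _ ha _ hc => hc ha, h₂⟩

theorem mem_R_cut {S : Set E} {h₁ : S.Nonempty} {h₂ : BddAbove S} {c : E} :
    c ∈ (cut S h₁ h₂).R ↔ ∀ a ∈ S, a ≤ c := Iff.rfl

/-- The cut of an element: `(Iic x, Ici x)`. -/
def of (x : E) : OrderCompletion E :=
  ⟨DedekindCut.principal x, ⟨x, le_rfl⟩, ⟨x, le_rfl⟩⟩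

theorem mem_L_of {x a : E} : a ∈ (of x).L ↔ a ≤ x := Iff.rfl

theorem mem_R_of {x c : E} : c ∈ (of x).R ↔ x ≤ c := Iff.rfl

theorem of_le_iff {x : E} {A : OrderCompletion E} : of x ≤ A ↔ x ∈ A.L :=
  DedekindCut.principal_le_iff

theorem le_of_iff {x : E} {A : OrderCompletion E} : A ≤ of x ↔ x ∈ A.R :=
  DedekindCut.le_principal_iff

theorem of_le_of {x y : E} : of x ≤ of y ↔ x ≤ y := DedekindCut.principal_le_principal

theorem of_injective : Function.Injective (of : E → OrderCompletion E) := fun _ _ h =>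
  le_antisymm (of_le_of.1 h.le) (of_le_of.1 h.ge)

theorem of_sup (x y : E) : of (x ⊔ y) = of x ⊔ of y := by
  apply le_antisymm
  · rw [le_iff_R]
    intro c hc
    rw [← le_of_iff, sup_le_iff, of_le_of, of_le_of] at hc
    exact sup_le hc.1 hc.2
  · exact sup_le (of_le_of.2 le_sup_left) (of_le_of.2 le_sup_right)

theorem of_inf (x y : E) : of (x ⊓ y) = of x ⊓ of y := by
  apply le_antisymm
  · exact le_inf (of_le_of.2 inf_le_left) (of_le_of.2 inf_le_right)
  · rw [le_iff_L]
    intro a ha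
    rw [← of_le_iff, le_inf_iff, of_le_of, of_le_of] at ha
    exact le_inf ha.1 ha.2

/-- The order completion is order complete. -/
theorem exists_isLUB (S : Set (OrderCompletion E)) (h₁ : S.Nonempty) (h₂ : BddAbove S) :
    ∃ B, IsLUB S B := by
  obtain ⟨A₀, hA₀⟩ := h₁
  obtain ⟨U, hU⟩ := h₂
  obtain ⟨a₀, ha₀⟩ := A₀.L_nonempty
  obtain ⟨u, hu⟩ := U.R_nonempty
  refine ⟨cut (⋃ A ∈ S, A.L) ⟨a₀, Set.mem_biUnion hA₀ ha₀⟩ ⟨u, ?_⟩, ?_, ?_⟩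
  · intro a ha
    obtain ⟨A, hA, ha⟩ := Set.mem_iUnion₂.1 ha
    exact mem_R.1 hu a (hU hA ha)
  · intro A hA
    rw [le_iff_R]
    intro c hc
    exact mem_R.2 fun a ha => hc (Set.mem_biUnion hA ha)
  · intro V hV
    rw [le_iff_R]
    intro c hc a ha
    obtain ⟨A, hA, ha⟩ := Set.mem_iUnion₂.1 ha
    exact mem_R.1 hc a (hV hA ha)

/-- Every element of the completion is the supremum of the elements of `E` below it. -/
theorem isLUB_of (A : OrderCompletion E) : IsLUB {B | ∃ x : E, of x ≤ A ∧ B = of x} A := by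
  refine ⟨by rintro _ ⟨x, hx, rfl⟩; exact hx, fun B hB => ?_⟩
  exact le_iff_L.2 fun a ha => of_le_iff.1 (hB ⟨a, of_le_iff.2 ha, rfl⟩)

/-- Every element of the completion is the infimum of the elements of `E` above it. -/
theorem isGLB_of (A : OrderCompletion E) : IsGLB {B | ∃ x : E, A ≤ of x ∧ B = of x} A := by
  refine ⟨by rintro _ ⟨x, hx, rfl⟩; exact hx, fun B hB => ?_⟩
  exact le_iff_R.2 fun a ha => le_of_iff.1 (hB ⟨a, le_of_iff.2 ha, rfl⟩)

/-- `E` is majorizing in its order completion. -/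
theorem exists_le_of (A : OrderCompletion E) : ∃ x : E, A ≤ of x :=
  A.R_nonempty.imp fun _ => le_of_iff.2

theorem sup_mem_L {A : OrderCompletion E} {a b : E} (ha : a ∈ A.L) (hb : b ∈ A.L) :
    a ⊔ b ∈ A.L :=
  mem_L.2 fun c hc => sup_le (mem_L.1 ha c hc) (mem_L.1 hb c hc)

end Order

section Algebra

variable {E : Type u} [AddCommGroup E] [Lattice E] [Module ℝ E] [ArchimedeanVectorLattice E]

instance : Zero (OrderCompletion E) := ⟨of 0⟩

/-- `A + B` is the cut generated by the sums `a + b` with `a`, `b` in the left halves. -/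
instance : Add (OrderCompletion E) where
  add A B := cut {c | ∃ a ∈ A.L, ∃ b ∈ B.L, a + b = c}
    (by
      obtain ⟨a, ha⟩ := A.L_nonempty
      obtain ⟨b, hb⟩ := B.L_nonempty
      exact ⟨_, a, ha, b, hb, rfl⟩)
    (by
      obtain ⟨a, ha⟩ := A.R_nonempty
      obtain ⟨b, hb⟩ := B.R_nonempty
      refine ⟨a + b, ?_⟩
      rintro _ ⟨a', ha', b', hb', rfl⟩
      exact add_le_add (mem_R.1 ha a' ha') (mem_R.1 hb b' hb'))

/-- `-A` is the cut generated by the negatives of the elements of the right half. -/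
instance : Neg (OrderCompletion E) where
  neg A := cut {c | -c ∈ A.R}
    (by
      obtain ⟨a, ha⟩ := A.R_nonempty
      exact ⟨-a, by simpa using ha⟩)
    (by
      obtain ⟨a, ha⟩ := A.L_nonempty
      refine ⟨-a, fun c hc => ?_⟩
      exact le_neg_of_le_neg (mem_R.1 hc a ha))

/-- For `r ≥ 0`, the cut generated by the multiples `r • a` with `a` in the left half. -/
def nnsmul (r : NNReal) (A : OrderCompletion E) : OrderCompletion E :=
  cut {c | ∃ a ∈ A.L, (r : ℝ) • a = c}
    (by
      obtain ⟨a, ha⟩ := A.L_nonempty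
      exact ⟨_, a, ha, rfl⟩)
    (by
      obtain ⟨a, ha⟩ := A.R_nonempty
      refine ⟨(r : ℝ) • a, ?_⟩
      rintro _ ⟨a', ha', rfl⟩
      exact smul_le_smul_of_nonneg_left (mem_R.1 ha a' ha') r.2)

theorem mem_R_add {A B : OrderCompletion E} {c : E} :
    c ∈ (A + B).R ↔ ∀ a ∈ A.L, ∀ b ∈ B.L, a + b ≤ c := by
  refine Iff.trans mem_R_cut ⟨fun h a ha b hb => h _ ⟨a, ha, b, hb, rfl⟩, ?_⟩
  rintro h _ ⟨a, ha, b, hb, rfl⟩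
  exact h a ha b hb

theorem mem_R_add' {A B : OrderCompletion E} {c : E} :
    c ∈ (A + B).R ↔ ∀ b ∈ B.L, c - b ∈ A.R := by
  rw [mem_R_add]
  refine ⟨fun h b hb => mem_R.2 fun a ha => le_sub_iff_add_le.2 (h a ha b hb), ?_⟩
  exact fun h a ha b hb => le_sub_iff_add_le.1 (mem_R.1 (h b hb) a ha)

theorem mem_R_neg {A : OrderCompletion E} {c : E} : c ∈ (-A).R ↔ -c ∈ A.L := by
  refine Iff.trans mem_R_cut ?_
  rw [mem_L]
  refine ⟨fun h a ha => ?_, fun h a ha => ?_⟩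
  · exact neg_le_of_neg_le (h (-a) (by simpa using ha))
  · exact le_of_neg_le_neg (h _ ha)

theorem mem_L_neg {A : OrderCompletion E} {c : E} : c ∈ (-A).L ↔ -c ∈ A.R := by
  rw [mem_L, mem_R]
  refine ⟨fun h a ha => ?_, fun h a ha => ?_⟩
  · exact le_neg_of_le_neg (h (-a) (mem_R_neg.2 (by simpa using ha)))
  · exact le_of_neg_le_neg (h _ (mem_R_neg.1 ha))

theorem mem_R_nnsmul {r : NNReal} {A : OrderCompletion E} {c : E} :
    c ∈ (nnsmul r A).R ↔ ∀ a ∈ A.L, (r : ℝ) • a ≤ c := by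
  refine Iff.trans mem_R_cut ⟨fun h a ha => h _ ⟨a, ha, rfl⟩, ?_⟩
  rintro h _ ⟨a, ha, rfl⟩
  exact h a ha

protected theorem add_comm' (A B : OrderCompletion E) : A + B = B + A :=
  ext_R fun c => by
    rw [mem_R_add, mem_R_add]
    exact ⟨fun h a ha b hb => add_comm a b ▸ h b hb a ha,
      fun h a ha b hb => add_comm a b ▸ h b hb a ha⟩

protected theorem add_zero' (A : OrderCompletion E) : A + 0 = A :=
  ext_R fun c => by
    rw [mem_R_add]
    refine ⟨fun h => mem_R.2 fun a ha => ?_, fun h a ha b hb => ?_⟩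
    · simpa using h a ha 0 (mem_L_of.2 le_rfl)
    · simpa using add_le_add (mem_R.1 h a ha) (mem_L_of.1 hb)

theorem mem_R_add_add {A B C : OrderCompletion E} {c : E} :
    c ∈ (A + B + C).R ↔ ∀ a ∈ A.L, ∀ b ∈ B.L, ∀ d ∈ C.L, a + b + d ≤ c := by
  rw [mem_R_add']
  refine ⟨fun h a ha b hb d hd => ?_, fun h d hd => ?_⟩
  · exact le_sub_iff_add_le.1 (mem_R_add.1 (h d hd) a ha b hb)
  · exact mem_R_add.2 fun a ha b hb => le_sub_iff_add_le.2 (h a ha b hb d hd)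

protected theorem neg_add' (A : OrderCompletion E) : -A + A = 0 :=
  ext_R fun c => by
    rw [mem_R_add]
    refine ⟨fun h => mem_R_of.2 ?_, fun h a ha b hb => ?_⟩
    · obtain ⟨a, ha⟩ := A.L_nonempty
      obtain ⟨v, hv⟩ := A.R_nonempty
      have step : ∀ w ∈ A.R, w + c ∈ A.R := fun w hw => mem_R.2 fun b hb => by
        have := h (-w) (mem_L_neg.2 (by simpa using hw)) b hb
        rwa [neg_add_le_iff_le_add] at this
      have steps : ∀ n : ℕ, v + n • c ∈ A.R := by
        intro n
        induction n with
        | zero => simpa using hv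
        | succ n ih => rw [succ_nsmul, ← add_assoc]; exact step _ ih
      have key : -c ≤ 0 := by
        refine ArchimedeanVectorLattice.le_zero_of_nsmul_le (-c) (v - a) fun n => ?_
        have := mem_R.1 (steps n) a ha
        rw [smul_neg, neg_le_iff_add_nonneg]
        rw [← sub_nonneg] at this
        convert this using 1
        abel
      simpa using key
    · have h1 := mem_R.1 (mem_L_neg.1 ha) b hb
      have h2 : a + b ≤ 0 := by simpa [add_comm] using add_le_add_left h1 a
      exact h2.trans (mem_R_of.1 h)

instance : AddCommGroup (OrderCompletion E) where
  add_assoc A B C := ext_R fun c => by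
    rw [mem_R_add_add, OrderCompletion.add_comm' A, mem_R_add_add]
    refine ⟨fun h b hb d hd a ha => ?_, fun h a ha b hb d hd => ?_⟩
    · rw [add_comm, ← add_assoc]; exact h a ha b hb d hd
    · rw [add_assoc, add_comm]; exact h b hb d hd a ha
  zero_add A := by rw [OrderCompletion.add_comm', OrderCompletion.add_zero']
  add_zero := OrderCompletion.add_zero'
  nsmul := nsmulRec
  zsmul := zsmulRec
  neg_add_cancel := OrderCompletion.neg_add'
  add_comm := OrderCompletion.add_comm'

theorem smul_mem_L_nnsmul {r : NNReal} {A : OrderCompletion E} {a : E} (ha : a ∈ A.L) :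
    (r : ℝ) • a ∈ (nnsmul r A).L :=
  mem_L.2 fun _ hc => mem_R_nnsmul.1 hc a ha

theorem add_mem_L_add {A B : OrderCompletion E} {a b : E} (ha : a ∈ A.L) (hb : b ∈ B.L) :
    a + b ∈ (A + B).L :=
  mem_L.2 fun _ hc => mem_R_add.1 hc a ha b hb

/-- A bound for all multiples `r • a`, `a ∈ A.L`, with `r > 0`, divided by `r`. -/
theorem inv_smul_mem_R {r : NNReal} (hr : 0 < r) {A : OrderCompletion E} {c : E} :
    (r : ℝ)⁻¹ • c ∈ A.R ↔ ∀ a ∈ A.L, (r : ℝ) • a ≤ c := by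
  rw [mem_R]
  exact forall₂_congr fun a _ => le_inv_smul_iff_of_pos (show (0 : ℝ) < r from hr)

theorem mem_R_nnsmul_pos {r : NNReal} (hr : 0 < r) {A : OrderCompletion E} {c : E} :
    c ∈ (nnsmul r A).R ↔ (r : ℝ)⁻¹ • c ∈ A.R := by
  rw [mem_R_nnsmul, inv_smul_mem_R hr]

theorem zero_nnsmul (A : OrderCompletion E) : nnsmul 0 A = 0 :=
  ext_R fun c => by
    rw [mem_R_nnsmul]
    refine ⟨fun h => ?_, fun h a _ => ?_⟩
    · obtain ⟨a, ha⟩ := A.L_nonempty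
      exact mem_R_of.2 (by simpa using h a ha)
    · simpa using mem_R_of.1 h

theorem one_nnsmul (A : OrderCompletion E) : nnsmul 1 A = A :=
  ext_R fun c => by rw [mem_R_nnsmul, mem_R]; simp

theorem nnsmul_zero (r : NNReal) : nnsmul r (0 : OrderCompletion E) = 0 :=
  ext_R fun c => by
    rw [mem_R_nnsmul]
    refine ⟨fun h => ?_, fun h a ha => ?_⟩
    · exact mem_R_of.2 (by simpa using h 0 (mem_L_of.2 le_rfl))
    · exact (smul_nonpos_of_nonneg_of_nonpos r.2 (mem_L_of.1 ha)).trans (mem_R_of.1 h)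

theorem nnsmul_add (r : NNReal) (A B : OrderCompletion E) :
    nnsmul r (A + B) = nnsmul r A + nnsmul r B := by
  rcases eq_or_ne r 0 with rfl | hr
  · simp [zero_nnsmul]
  have hr : 0 < r := pos_iff_ne_zero.2 hr
  refine ext_R fun c => ?_
  rw [mem_R_nnsmul_pos hr, mem_R_add, OrderCompletion.mem_R_add']
  have hr' : (0 : ℝ) < r := hr
  have e : ∀ a b : E, a + b ≤ (r : ℝ)⁻¹ • c ↔ (r : ℝ) • a + (r : ℝ) • b ≤ c := fun a b => by
    rw [le_inv_smul_iff_of_pos hr', smul_add]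
  simp only [e]
  constructor
  · intro h b hb
    rw [mem_R_nnsmul]
    intro a ha
    have hb' : b ∈ (nnsmul r B).L := hb
    rw [mem_L] at hb'
    have : b ≤ c - (r : ℝ) • a := hb' _ (mem_R_nnsmul.2 fun d hd => by
      rw [le_sub_iff_add_le, add_comm]; exact h a ha d hd)
    rw [le_sub_iff_add_le, add_comm]
    exact le_sub_iff_add_le.1 this
  · intro h a ha b hb
    exact le_sub_iff_add_le.1 (mem_R_nnsmul.1 (h _ (smul_mem_L_nnsmul hb)) a ha)

theorem add_nnsmul (r s : NNReal) (A : OrderCompletion E) :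
    nnsmul (r + s) A = nnsmul r A + nnsmul s A := by
  refine ext_R fun c => ?_
  rw [mem_R_nnsmul, mem_R_add']
  constructor
  · intro h b hb
    rw [mem_R_nnsmul]
    intro a ha
    have : b ≤ c - (r : ℝ) • a := mem_L.1 hb _ (mem_R_nnsmul.2 fun d hd => by
      rw [le_sub_iff_add_le, add_comm]
      refine le_trans ?_ (h (a ⊔ d) (sup_mem_L ha hd))
      rw [NNReal.coe_add, add_smul]
      exact add_le_add (smul_le_smul_of_nonneg_left le_sup_left r.2)
        (smul_le_smul_of_nonneg_left le_sup_right s.2))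
    rw [le_sub_iff_add_le, add_comm]
    exact le_sub_iff_add_le.1 this
  · intro h a ha
    rw [NNReal.coe_add, add_smul]
    exact le_sub_iff_add_le.1 (mem_R_nnsmul.1 (h _ (smul_mem_L_nnsmul ha)) a ha)

theorem mul_nnsmul (r s : NNReal) (A : OrderCompletion E) :
    nnsmul (r * s) A = nnsmul r (nnsmul s A) := by
  rcases eq_or_ne r 0 with rfl | hr
  · simp [zero_nnsmul]
  rcases eq_or_ne s 0 with rfl | hs
  · simp [zero_nnsmul, nnsmul_zero]
  have hr : 0 < r := pos_iff_ne_zero.2 hr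
  have hs : 0 < s := pos_iff_ne_zero.2 hs
  refine ext_R fun c => ?_
  rw [mem_R_nnsmul_pos (mul_pos hr hs), mem_R_nnsmul_pos hr, mem_R_nnsmul_pos hs, smul_smul,
    NNReal.coe_mul, mul_inv, mul_comm]

/-- Multiplication by a real number `r = r⁺ - r⁻`: the difference of the multiples of `A` by the
positive part and by the negative part of `r` (one of which vanishes). -/
instance : SMul ℝ (OrderCompletion E) where
  smul r A := nnsmul r.toNNReal A - nnsmul (-r).toNNReal A

theorem smul_eq {r : ℝ} {p q : NNReal} (h : r = p - q) (A : OrderCompletion E) :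
    r • A = nnsmul p A - nnsmul q A := by
  change nnsmul r.toNNReal A - nnsmul (-r).toNNReal A = _
  rw [sub_eq_sub_iff_add_eq_add, ← add_nnsmul, ← add_nnsmul]
  congr 1
  ext
  have := max_zero_sub_max_neg_zero_eq_self r
  simp only [NNReal.coe_add, Real.coe_toNNReal']
  linarith

theorem coe_smul (r : NNReal) (A : OrderCompletion E) : (r : ℝ) • A = nnsmul r A := by
  rw [smul_eq (p := r) (q := 0) (by simp), zero_nnsmul, sub_zero]

theorem exists_nnreal_sub (r : ℝ) : ∃ p q : NNReal, r = p - q :=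
  ⟨r.toNNReal, (-r).toNNReal, by
    simp⟩

theorem nnsmul_sub (r : NNReal) (A B : OrderCompletion E) :
    nnsmul r (A - B) = nnsmul r A - nnsmul r B := by
  rw [eq_sub_iff_add_eq, ← nnsmul_add, sub_add_cancel]

instance : Module ℝ (OrderCompletion E) where
  one_smul A := by
    rw [← NNReal.coe_one, coe_smul, one_nnsmul]
  mul_smul r s A := by
    obtain ⟨p, q, h⟩ := exists_nnreal_sub r
    obtain ⟨p', q', h'⟩ := exists_nnreal_sub s
    rw [smul_eq (p := p * p' + q * q') (q := p * q' + q * p') (by push_cast; rw [h, h']; ring),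
      smul_eq h', smul_eq h]
    simp only [nnsmul_sub, add_nnsmul, mul_nnsmul]
    abel
  smul_zero r := by
    obtain ⟨p, q, h⟩ := exists_nnreal_sub r
    rw [smul_eq h, nnsmul_zero, nnsmul_zero, sub_zero]
  smul_add r A B := by
    obtain ⟨p, q, h⟩ := exists_nnreal_sub r
    simp only [smul_eq h, nnsmul_add]
    abel
  add_smul r s A := by
    obtain ⟨p, q, h⟩ := exists_nnreal_sub r
    obtain ⟨p', q', h'⟩ := exists_nnreal_sub s
    rw [smul_eq (p := p + p') (q := q + q') (by push_cast; rw [h, h']; ring),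
      smul_eq h', smul_eq h]
    simp only [add_nnsmul]
    abel
  zero_smul A := by
    rw [smul_eq (p := 0) (q := 0) (by simp), sub_self]

theorem of_add (x y : E) : of (x + y) = of x + of y :=
  ext_R fun c => by
    rw [mem_R_add, mem_R_of]
    exact ⟨fun h a ha b hb => (add_le_add (mem_L_of.1 ha) (mem_L_of.1 hb)).trans h,
      fun h => h x (mem_L_of.2 le_rfl) y (mem_L_of.2 le_rfl)⟩

theorem of_nnsmul (r : NNReal) (x : E) : of ((r : ℝ) • x) = nnsmul r (of x) :=
  ext_R fun c => by
    rw [mem_R_nnsmul, mem_R_of]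
    exact ⟨fun h a ha => (smul_le_smul_of_nonneg_left (mem_L_of.1 ha) r.2).trans h,
      fun h => h x (mem_L_of.2 le_rfl)⟩

/-- The canonical linear embedding of `E` into its order completion. -/
def ofLinear : E →ₗ[ℝ] OrderCompletion E where
  toFun := of
  map_add' := of_add
  map_smul' r x := by
    obtain ⟨p, q, h⟩ := exists_nnreal_sub r
    rw [RingHom.id_apply, smul_eq h, ← of_nnsmul, ← of_nnsmul, eq_sub_iff_add_eq, ← of_add,
      ← add_smul, h, sub_add_cancel]

/-- The order completion is again an Archimedean vector lattice. -/
instance : ArchimedeanVectorLattice (OrderCompletion E) :=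
  have hadd : ∀ A B : OrderCompletion E, A ≤ B → ∀ C, A + C ≤ B + C := fun A B h C =>
    le_iff_R.2 fun c hc => mem_R_add.2 fun a ha b hb => mem_R_add.1 hc a (h ha) b hb
  have hord : IsOrderedAddMonoid (OrderCompletion E) := { add_le_add_left := fun A B h C => hadd A B h C }
  have hnn : ∀ (r : NNReal) (A B : OrderCompletion E), A ≤ B → nnsmul r A ≤ nnsmul r B :=
    fun r A B h => le_iff_R.2 fun c hc => mem_R_nnsmul.2 fun a ha => mem_R_nnsmul.1 hc a (h ha)
  have hpos : ∀ (r : ℝ) (A : OrderCompletion E), 0 ≤ r → 0 ≤ A → 0 ≤ r • A := fun r A hr hA => by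
    lift r to NNReal using hr
    rw [coe_smul, ← nnsmul_zero r]
    exact hnn r _ _ hA
  { hord with
    smul_le_smul_of_nonneg_left := fun r hr A B h => by
      have := hpos r (B - A) hr (sub_nonneg.2 h)
      rwa [smul_sub, sub_nonneg] at this
    smul_le_smul_of_nonneg_right := fun A hA r s h => by
      have := hpos (s - r) A (sub_nonneg.2 h) hA
      rwa [sub_smul, sub_nonneg] at this
    le_zero_of_nsmul_le := fun A B h => le_iff_L.2 fun a ha => by
      obtain ⟨b, hb⟩ := B.R_nonempty
      refine mem_L_of.2 (ArchimedeanVectorLattice.le_zero_of_nsmul_le a b fun n => ?_)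
      have h1 : of (n • a) ≤ n • A := by
        have : of (n • a) = n • of a := map_nsmul (ofLinear (E := E)) n a
        rw [this]
        exact nsmul_le_nsmul_right (of_le_iff.2 ha) n
      exact of_le_of.1 (h1.trans ((h n).trans (le_of_iff.2 hb))) }

/-- The canonical copy of `E` inside its order completion. -/
def base (E : Type u) [AddCommGroup E] [Lattice E] [Module ℝ E] [ArchimedeanVectorLattice E] :
    VectorSublattice (OrderCompletion E) where
  toSubmodule := LinearMap.range (ofLinear (E := E))
  sup_mem' := by
    rintro _ _ ⟨x, rfl⟩ ⟨y, rfl⟩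
    exact ⟨x ⊔ y, of_sup x y⟩
  inf_mem' := by
    rintro _ _ ⟨x, rfl⟩ ⟨y, rfl⟩
    exact ⟨x ⊓ y, of_inf x y⟩

end Algebra

end OrderCompletion

/-! ### The uniform completion -/

/-- The uniform completion of `E`: the intersection of all uniformly complete sublattices of the
order completion of `E` that contain `E`. -/
def uniformCompletion (E : Type u) [AddCommGroup E] [Lattice E] [Module ℝ E]
    [ArchimedeanVectorLattice E] : VectorSublattice (OrderCompletion E) :=
  (OrderCompletion.base E).uniformlyCompleteHull

/-- The inclusion of `E` into its uniform completion. -/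
def toUniformCompletion {E : Type u} [AddCommGroup E] [Lattice E] [Module ℝ E]
    [ArchimedeanVectorLattice E] (x : E) : uniformCompletion E :=
  ⟨OrderCompletion.of x, fun _ hY _ => hY _ ⟨x, rfl⟩⟩

/-! ### Archimedean estimates -/

section Archimedean

variable {E : Type u} [AddCommGroup E] [Lattice E] [Module ℝ E] [ArchimedeanVectorLattice E]

/-! Both hulls are compared with a third one. In the product `W = X^δ × Z`, which is uniformly
complete, let `D` be the diagonal copy of `X`. The two coordinate projections are lattice
homomorphisms that are injective on `D`, and each maps the hull of `D` isomorphically onto the hull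
of `X` in its factor. The required isomorphism is the inverse of the first projection followed by
the second.

In a uniformly complete space the uniformly complete sublattices are exactly the uniformly closed
ones, with regulators taken in the sublattice (`uniformlyComplete_iff`), so hulls can be treated as
closures. Preimages of closed sublattices under a lattice homomorphism `T` are closed. Images are
closed when `T` is injective on the sublattice, because `T` is then an order embedding there and
Cauchy estimates pull back.

The crux is that injectivity passes from `D` to its hull (`eq_zero_of_mem_uniformlyCompleteHull`).
If `T` is injective on `G` and `w` is a uniform limit from `G` with `T w = 0`, the approximants have
small images. They are therefore small themselves, and `w = 0` by the Archimedean property. A single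
adherence step is not claimed to produce a closed set, so Zorn's lemma supplies a maximal, hence
closed, sublattice on which `T` is injective. -/

theorem le_zero_of_forall_le_smul {x e : E} (h : ∀ ε : ℝ, 0 < ε → x ≤ ε • e) : x ≤ 0 := by
  -- The bound must also be valid for `n = 0`, hence `e ⊔ 0` in place of `e`.
  refine ArchimedeanVectorLattice.le_zero_of_nsmul_le x (e ⊔ 0) fun n => ?_
  rcases n.eq_zero_or_pos with rfl | hn
  · simp
  · have hn' : (0 : ℝ) < n := Nat.cast_pos.2 hn
    have := smul_le_smul_of_nonneg_left (h (n : ℝ)⁻¹ (inv_pos.2 hn')) hn'.le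
    rw [smul_inv_smul₀ hn'.ne', Nat.cast_smul_eq_nsmul] at this
    exact this.trans le_sup_left

theorem le_of_forall_le_add_smul {x y e : E} (h : ∀ ε : ℝ, 0 < ε → x ≤ y + ε • e) : x ≤ y :=
  sub_nonpos.1 (le_zero_of_forall_le_smul fun ε hε => sub_le_iff_le_add'.2 (h ε hε))

theorem eq_zero_of_abs_le_zero {x : E} (h : |x| ≤ 0) : x = 0 :=
  le_antisymm ((le_abs_self x).trans h) (neg_nonpos.1 ((neg_le_abs x).trans h))

theorem eq_zero_of_forall_abs_le_smul {x e : E} (h : ∀ ε : ℝ, 0 < ε → |x| ≤ ε • e) : x = 0 :=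
  eq_zero_of_abs_le_zero (le_zero_of_forall_le_smul h)

theorem abs_sub_le_add_abs_sub (a b c : E) : |a - c| ≤ |a - b| + |b - c| := by
  simpa using abs_add_le (a - b) (b - c)

theorem smul_le_abs_smul_abs (r : ℝ) (x : E) : r • x ≤ |r| • |x| := by
  rcases le_total 0 r with hr | hr
  · rw [abs_of_nonneg hr]
    exact smul_le_smul_of_nonneg_left (le_abs_self x) hr
  · rw [abs_of_nonpos hr, ← neg_smul_neg]
    exact smul_le_smul_of_nonneg_left (neg_le_abs x) (neg_nonneg.2 hr)

theorem abs_smul_le (r : ℝ) (x : E) : |r • x| ≤ |r| • |x| :=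
  abs_le'.2 ⟨smul_le_abs_smul_abs r x, by simpa using smul_le_abs_smul_abs (-r) x⟩

theorem abs_sup_sub_sup_le_add (a b c d : E) : |a ⊔ b - c ⊔ d| ≤ |a - c| + |b - d| := by
  refine (abs_sub_le_add_abs_sub _ (c ⊔ b) _).trans ?_
  refine add_le_add (abs_sup_sub_sup_le_abs a c b) ?_
  rw [sup_comm c b, sup_comm c d]
  exact abs_sup_sub_sup_le_abs b d c

theorem abs_inf_sub_inf_le_add (a b c d : E) : |a ⊓ b - c ⊓ d| ≤ |a - c| + |b - d| := by
  refine (abs_sub_le_add_abs_sub _ (c ⊓ b) _).trans ?_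
  refine add_le_add (abs_inf_sub_inf_le_abs a c b) ?_
  rw [inf_comm c b, inf_comm c d]
  exact abs_inf_sub_inf_le_abs b d c

theorem nonneg_of_abs_le_one_smul {x e : E} (h : |x| ≤ (1 : ℝ) • e) : 0 ≤ e := by
  simpa using (abs_nonneg x).trans h

end Archimedean

/-! ### Uniform limits and their regulators -/

section Nets

variable {E : Type u} [AddCommGroup E] [Lattice E] [Module ℝ E] [ArchimedeanVectorLattice E]

/-- A uniformly Cauchy net that converges uniformly does so relative to each of its Cauchy
regulators. -/
theorem UniformlyConverges.rel_of_cauchy {Λ : Type u} [Preorder Λ] [IsDirectedOrder Λ]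
    {x : Λ → E} {l e : E} (hx : UniformlyConverges x l)
    (hc : UniformlyConvergesRel e (fun p : Λ × Λ => x p.1 - x p.2) 0) :
    UniformlyConvergesRel e x l := by
  intro ε hε
  obtain ⟨e', -, hx⟩ := hx
  obtain ⟨⟨α₀, β₀⟩, h₀⟩ := hc ε hε
  -- Compare `x α` with a far term `x β`: the Cauchy estimate costs `ε • e`, and the error `δ • e'`
  -- in the foreign regulator vanishes by the Archimedean property, since `α₀` does not depend on
  -- `δ`.
  refine ⟨α₀, fun α hα => le_of_forall_le_add_smul (e := e') fun δ hδ => ?_⟩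
  obtain ⟨γ, hγ⟩ := hx δ hδ
  obtain ⟨β, hβ, hβγ⟩ := exists_ge_ge β₀ γ
  refine (abs_sub_le_add_abs_sub _ (x β) _).trans (add_le_add ?_ (hγ β hβγ))
  simpa using h₀ (α, β) ⟨hα, hβ⟩

/-- A sequence that is uniformly Cauchy relative to `e`, with the rate `1 / (n + 1)`, has a uniform
limit relative to `e`. -/
theorem UniformlyComplete.exists_seq_limit (hE : UniformlyComplete E) {g : ℕ → E} {e : E}
    (hg : ∀ m n : ℕ, |g m - g n| ≤ ((m + 1 : ℝ)⁻¹ + (n + 1 : ℝ)⁻¹) • e) :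
    ∃ l : E, ∀ ε : ℝ, 0 < ε → ∃ N : ℕ, ∀ n, N ≤ n → |g n - l| ≤ ε • e := by
  -- The case `m = n = 0` of the hypothesis reads `0 ≤ 2 • e`.
  have he : 0 ≤ e := by
    have h := (abs_nonneg _).trans (hg 0 0)
    have := smul_le_smul_of_nonneg_left h (show (0 : ℝ) ≤ 2⁻¹ by norm_num)
    rwa [smul_zero, smul_smul, show (2 : ℝ)⁻¹ * (((0 : ℕ) + 1 : ℝ)⁻¹ + ((0 : ℕ) + 1 : ℝ)⁻¹) = 1 by
      norm_num, one_smul] at this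
  -- The index set is lifted because nets are indexed by types in the universe of `E`.
  have hc : UniformlyConvergesRel e
      (fun p : ULift.{u} ℕ × ULift.{u} ℕ => g p.1.down - g p.2.down) 0 := by
    intro ε hε
    obtain ⟨N, hN⟩ := exists_nat_one_div_lt (half_pos hε)
    have key : ∀ n : ℕ, N ≤ n → (n + 1 : ℝ)⁻¹ ≤ ε / 2 := fun n hn => by
      refine le_trans ?_ hN.le
      rw [one_div]
      gcongr
    refine ⟨(⟨N⟩, ⟨N⟩), fun p hp => ?_⟩
    have h1 : N ≤ p.1.down := hp.1
    have h2 : N ≤ p.2.down := hp.2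
    rw [sub_zero]
    refine (hg _ _).trans (smul_le_smul_of_nonneg_right ?_ he)
    linarith [key _ h1, key _ h2]
  obtain ⟨l, hl⟩ := hE (ULift.{u} ℕ) (fun n => g n.down) ⟨e, he, hc⟩
  refine ⟨l, fun ε hε => ?_⟩
  obtain ⟨⟨N⟩, hN⟩ := hl.rel_of_cauchy hc ε hε
  exact ⟨N, fun n hn => hN ⟨n⟩ hn⟩

theorem abs_sub_le_of_approx {w d : E} {g : ℕ → E}
    (hg : ∀ n : ℕ, |w - g n| ≤ (n + 1 : ℝ)⁻¹ • d) (m n : ℕ) :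
    |g m - g n| ≤ ((m + 1 : ℝ)⁻¹ + (n + 1 : ℝ)⁻¹) • d := by
  rw [add_smul]
  refine (abs_sub_le_add_abs_sub _ w _).trans (add_le_add ?_ (hg n))
  rw [abs_sub_comm]
  exact hg m

/-- Uniqueness of uniform limits: it identifies a limit produced by completeness with the point that
was approximated. -/
theorem eq_of_approx {w l d : E} {g : ℕ → E} (hg : ∀ n : ℕ, |w - g n| ≤ (n + 1 : ℝ)⁻¹ • d)
    (hl : ∀ ε : ℝ, 0 < ε → ∃ N : ℕ, ∀ n, N ≤ n → |g n - l| ≤ ε • d) : w = l := by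
  have hd : 0 ≤ d := nonneg_of_abs_le_one_smul (by simpa using hg 0)
  refine sub_eq_zero.1 (eq_zero_of_forall_abs_le_smul (e := d) fun ε hε => ?_)
  obtain ⟨N, hN⟩ := hl (ε / 2) (half_pos hε)
  obtain ⟨M, hM⟩ := exists_nat_one_div_lt (half_pos hε)
  refine (abs_sub_le_add_abs_sub _ (g (max M N)) _).trans ?_
  rw [← add_halves ε, add_smul]
  refine add_le_add ((hg _).trans (smul_le_smul_of_nonneg_right ?_ hd)) (hN _ (le_max_right _ _))
  refine le_trans ?_ hM.le
  rw [one_div]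
  gcongr
  exact le_max_left _ _

end Nets

/-! ### Uniformly complete sublattices are the uniformly closed ones -/

namespace VectorSublattice

variable {E : Type u} [AddCommGroup E] [Lattice E] [Module ℝ E]

/-- `Y` contains every point that is approximated by elements of `Y` relative to a regulator
in `Y`. -/
def UniformlyClosed (Y : VectorSublattice E) : Prop :=
  ∀ w : E, ∀ d ∈ Y, (∀ ε : ℝ, 0 < ε → ∃ g ∈ Y, |w - g| ≤ ε • d) → w ∈ Y

theorem abs_mem {Y : VectorSublattice E} {a : E} (ha : a ∈ Y) : |a| ∈ Y :=
  Y.sup_mem' ha (neg_mem ha)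

theorem mem_uniformlyCompleteHull_of_mem {X : VectorSublattice E} {x : E} (hx : x ∈ X) :
    x ∈ X.uniformlyCompleteHull := fun _ hY _ => hY x hx

/-- The union of a non-empty chain of sublattices. -/
def unionOfChain (c : Set (VectorSublattice E)) (hne : c.Nonempty)
    (hc : ∀ G ∈ c, ∀ G' ∈ c, (∀ g ∈ G, g ∈ G') ∨ ∀ g ∈ G', g ∈ G) : VectorSublattice E :=
  have both : ∀ {a b : E}, (∃ G ∈ c, a ∈ G) → (∃ G ∈ c, b ∈ G) → ∃ G ∈ c, a ∈ G ∧ b ∈ G := by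
    rintro a b ⟨G, hG, ha⟩ ⟨G', hG', hb⟩
    rcases hc G hG G' hG' with h | h
    exacts [⟨G', hG', h a ha, hb⟩, ⟨G, hG, ha, h b hb⟩]
  { carrier := {g | ∃ G ∈ c, g ∈ G}
    add_mem' := fun ha hb =>
      let ⟨G, hG, ha, hb⟩ := both ha hb
      ⟨G, hG, add_mem ha hb⟩
    zero_mem' := hne.imp fun G hG => ⟨hG, zero_mem G⟩
    smul_mem' := fun r _ ⟨G, hG, ha⟩ => ⟨G, hG, SMulMemClass.smul_mem r ha⟩
    sup_mem' := fun ha hb =>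
      let ⟨G, hG, ha, hb⟩ := both ha hb
      ⟨G, hG, G.sup_mem' ha hb⟩
    inf_mem' := fun ha hb =>
      let ⟨G, hG, ha, hb⟩ := both ha hb
      ⟨G, hG, G.inf_mem' ha hb⟩ }

/-! ### Lattice homomorphisms: order reflection, preimages and images of sublattices -/

section Hom

variable {F : Type u} [AddCommGroup F] [Lattice F] [Module ℝ F] {T : E →ₗ[ℝ] F}

theorem map_abs_of_map_sup (hsup : ∀ a b, T (a ⊔ b) = T a ⊔ T b) (a : E) : T |a| = |T a| := by
  simp only [abs, hsup, map_neg]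

/-- The element `a ⊔ b - b` lies in `G` and is killed by `T`. Thus injectivity on a sublattice
already makes `T` an order embedding there. -/
theorem le_of_map_le {G : VectorSublattice E} (hsup : ∀ a b, T (a ⊔ b) = T a ⊔ T b)
    (hG : ∀ g ∈ G, T g = 0 → g = 0) {a b : E} (ha : a ∈ G) (hb : b ∈ G) (h : T a ≤ T b) :
    a ≤ b := by
  have := hG (a ⊔ b - b) (sub_mem (G.sup_mem' ha hb) hb) (by
    rw [map_sub, hsup, sup_eq_right.2 h, sub_self])
  exact sup_eq_right.1 (sub_eq_zero.1 this)

theorem abs_le_of_abs_map_le {G : VectorSublattice E} (hsup : ∀ a b, T (a ⊔ b) = T a ⊔ T b)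
    (hG : ∀ g ∈ G, T g = 0 → g = 0) {a b : E} (ha : a ∈ G) (hb : b ∈ G) (h : |T a| ≤ T b) :
    |a| ≤ b :=
  le_of_map_le hsup hG (abs_mem ha) hb (by rwa [map_abs_of_map_sup hsup])

theorem map_mono_of_map_sup (hsup : ∀ a b, T (a ⊔ b) = T a ⊔ T b) {a b : E} (h : a ≤ b) :
    T a ≤ T b := by
  rw [← sup_eq_right, ← hsup, sup_eq_right.2 h]

/-- The preimage of a sublattice under a lattice homomorphism. -/
def comap (Y : VectorSublattice F) (hsup : ∀ a b, T (a ⊔ b) = T a ⊔ T b)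
    (hinf : ∀ a b, T (a ⊓ b) = T a ⊓ T b) : VectorSublattice E where
  toSubmodule := Y.toSubmodule.comap T
  sup_mem' {a b} ha hb := by
    change T (a ⊔ b) ∈ Y
    rw [hsup]
    exact Y.sup_mem' ha hb
  inf_mem' {a b} ha hb := by
    change T (a ⊓ b) ∈ Y
    rw [hinf]
    exact Y.inf_mem' ha hb

/-- The image of a sublattice under a lattice homomorphism. -/
def map (Y : VectorSublattice E) (hsup : ∀ a b, T (a ⊔ b) = T a ⊔ T b)
    (hinf : ∀ a b, T (a ⊓ b) = T a ⊓ T b) : VectorSublattice F where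
  toSubmodule := Y.toSubmodule.map T
  sup_mem' := by
    rintro _ _ ⟨a, ha, rfl⟩ ⟨b, hb, rfl⟩
    exact ⟨a ⊔ b, Y.sup_mem' ha hb, hsup a b⟩
  inf_mem' := by
    rintro _ _ ⟨a, ha, rfl⟩ ⟨b, hb, rfl⟩
    exact ⟨a ⊓ b, Y.inf_mem' ha hb, hinf a b⟩

theorem UniformlyClosed.comap {Y : VectorSublattice F} (hY : Y.UniformlyClosed)
    (hsup : ∀ a b, T (a ⊔ b) = T a ⊔ T b) (hinf : ∀ a b, T (a ⊓ b) = T a ⊓ T b) :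
    (Y.comap hsup hinf).UniformlyClosed := by
  intro w d hd h
  refine hY (T w) (T d) hd fun ε hε => ?_
  obtain ⟨g, hg, hwg⟩ := h ε hε
  refine ⟨T g, hg, ?_⟩
  rw [← map_sub, ← map_abs_of_map_sup hsup, ← map_smul]
  exact map_mono_of_map_sup hsup hwg

/-- `G` extends `D`, is majorized by `D`, and `T` is injective on `G`. -/
structure InjectiveExtension (T : E →ₗ[ℝ] F) (D G : VectorSublattice E) : Prop where
  subset : ∀ d ∈ D, d ∈ G
  majorized : ∀ g ∈ G, ∃ d ∈ D, |g| ≤ d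
  injective : ∀ g ∈ G, T g = 0 → g = 0

end Hom

variable [ArchimedeanVectorLattice E]

/-- Approximants with error `1 / (n + 1)` form a Cauchy sequence in `Y` whose regulator `d` is also
in `Y`; its limit in `Y` must be `w`. -/
theorem uniformlyClosed_of_uniformlyComplete {Y : VectorSublattice E} (hY : UniformlyComplete Y) :
    Y.UniformlyClosed := by
  intro w d hd h
  choose g hgY hg using fun n : ℕ => h (n + 1 : ℝ)⁻¹ (by positivity)
  obtain ⟨l, hl⟩ := hY.exists_seq_limit (g := fun n => ⟨g n, hgY n⟩) (e := ⟨d, hd⟩)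
    fun m n => abs_sub_le_of_approx hg m n
  have hwl : w = l := eq_of_approx hg hl
  exact hwl ▸ l.2

/-- The limit exists in `E`, a priori with a regulator outside `Y`;
`UniformlyConverges.rel_of_cauchy` brings it back to the Cauchy regulator `e`, which is in `Y`. -/
theorem UniformlyClosed.uniformlyComplete (hE : UniformlyComplete E) {Y : VectorSublattice E}
    (hY : Y.UniformlyClosed) : UniformlyComplete Y := by
  intro Λ _ _ _ x ⟨e, he, hx⟩
  have hx' : UniformlyConvergesRel (e : E)
      (fun p : Λ × Λ => (x p.1 : E) - (x p.2 : E)) 0 := fun ε hε => hx ε hε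
  obtain ⟨l, hl⟩ := hE Λ (fun α => (x α : E)) ⟨e, he, hx'⟩
  have hle := hl.rel_of_cauchy hx'
  have hlY : l ∈ Y := by
    refine hY l e e.2 fun ε hε => ?_
    obtain ⟨α, hα⟩ := hle ε hε
    refine ⟨x α, (x α).2, ?_⟩
    rw [abs_sub_comm]
    exact hα α le_rfl
  exact ⟨⟨l, hlY⟩, e, he, hle⟩

theorem uniformlyComplete_iff (hE : UniformlyComplete E) {Y : VectorSublattice E} :
    UniformlyComplete Y ↔ Y.UniformlyClosed :=
  ⟨uniformlyClosed_of_uniformlyComplete, UniformlyClosed.uniformlyComplete hE⟩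

theorem mem_uniformlyCompleteHull_iff (hE : UniformlyComplete E) {X : VectorSublattice E} {z : E} :
    z ∈ X.uniformlyCompleteHull ↔
      ∀ Y : VectorSublattice E, (∀ x ∈ X, x ∈ Y) → Y.UniformlyClosed → z ∈ Y :=
  forall₂_congr fun _ _ => by rw [uniformlyComplete_iff hE]

/-- Closedness survives intersection because a regulator in the hull lies in every sublattice being
intersected. -/
theorem uniformlyClosed_uniformlyCompleteHull (hE : UniformlyComplete E) (X : VectorSublattice E) :
    X.uniformlyCompleteHull.UniformlyClosed := by
  intro w d hd h
  rw [mem_uniformlyCompleteHull_iff hE]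
  intro Y hXY hY
  refine hY w d ((mem_uniformlyCompleteHull_iff hE).1 hd Y hXY hY) fun ε hε => ?_
  obtain ⟨g, hg, hwg⟩ := h ε hε
  exact ⟨g, (mem_uniformlyCompleteHull_iff hE).1 hg Y hXY hY, hwg⟩

/-! ### Lattice homomorphisms on hulls -/

/-- The points that are approximated by elements of `G` relative to a regulator in `D`. -/
def uniformAdherence (D G : VectorSublattice E) : VectorSublattice E where
  carrier := {w | ∃ d ∈ D, ∀ ε : ℝ, 0 < ε → ∃ g ∈ G, |w - g| ≤ ε • d}
  add_mem' := by
    rintro w w' ⟨d, hd, h⟩ ⟨d', hd', h'⟩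
    refine ⟨d + d', add_mem hd hd', fun ε hε => ?_⟩
    obtain ⟨g, hg, hwg⟩ := h ε hε
    obtain ⟨g', hg', hwg'⟩ := h' ε hε
    refine ⟨g + g', add_mem hg hg', ?_⟩
    rw [add_sub_add_comm, smul_add]
    exact (abs_add_le _ _).trans (add_le_add hwg hwg')
  zero_mem' := ⟨0, zero_mem D, fun _ _ => ⟨0, zero_mem G, by simp⟩⟩
  smul_mem' := by
    rintro r w ⟨d, hd, h⟩
    refine ⟨|r| • d, SMulMemClass.smul_mem _ hd, fun ε hε => ?_⟩
    obtain ⟨g, hg, hwg⟩ := h ε hε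
    refine ⟨r • g, SMulMemClass.smul_mem _ hg, ?_⟩
    rw [← smul_sub, smul_comm]
    exact (abs_smul_le _ _).trans (smul_le_smul_of_nonneg_left hwg (abs_nonneg r))
  sup_mem' := by
    rintro w w' ⟨d, hd, h⟩ ⟨d', hd', h'⟩
    refine ⟨d + d', add_mem hd hd', fun ε hε => ?_⟩
    obtain ⟨g, hg, hwg⟩ := h ε hε
    obtain ⟨g', hg', hwg'⟩ := h' ε hε
    refine ⟨g ⊔ g', G.sup_mem' hg hg', ?_⟩
    rw [smul_add]
    exact (abs_sup_sub_sup_le_add _ _ _ _).trans (add_le_add hwg hwg')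
  inf_mem' := by
    rintro w w' ⟨d, hd, h⟩ ⟨d', hd', h'⟩
    refine ⟨d + d', add_mem hd hd', fun ε hε => ?_⟩
    obtain ⟨g, hg, hwg⟩ := h ε hε
    obtain ⟨g', hg', hwg'⟩ := h' ε hε
    refine ⟨g ⊓ g', G.inf_mem' hg hg', ?_⟩
    rw [smul_add]
    exact (abs_inf_sub_inf_le_add _ _ _ _).trans (add_le_add hwg hwg')

theorem mem_uniformAdherence_of_mem {D G : VectorSublattice E} {g : E} (hg : g ∈ G) :
    g ∈ uniformAdherence D G :=
  ⟨0, zero_mem D, fun _ _ => ⟨g, hg, by simp⟩⟩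

section Hom

variable {F : Type u} [AddCommGroup F] [Lattice F] [Module ℝ F]
  {T : E →ₗ[ℝ] F}

/-- If `T w = 0` and `|w - g| ≤ ε • d`, then `|T g| ≤ T (ε • d)`. Both `g` and `ε • d` lie in `G`,
where `T` reflects order, so `|g| ≤ ε • d` and `|w| ≤ 2 ε • d` for every `ε`. -/
theorem InjectiveExtension.uniformAdherence {D G : VectorSublattice E}
    (hsup : ∀ a b, T (a ⊔ b) = T a ⊔ T b) (h : InjectiveExtension T D G) :
    InjectiveExtension T D (uniformAdherence D G) where
  subset d hd := mem_uniformAdherence_of_mem (h.subset d hd)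
  majorized := by
    rintro w ⟨d, hd, hw⟩
    obtain ⟨g, hg, hwg⟩ := hw 1 one_pos
    obtain ⟨d', hd', hgd⟩ := h.majorized g hg
    refine ⟨d + d', add_mem hd hd', ?_⟩
    rw [one_smul] at hwg
    simpa using (abs_add_le (w - g) g).trans (add_le_add hwg hgd)
  injective := by
    rintro w ⟨d, hd, hw⟩ hTw
    refine eq_zero_of_forall_abs_le_smul (e := (2 : ℝ) • d) fun ε hε => ?_
    obtain ⟨g, hg, hwg⟩ := hw ε hε
    have hTg : |T g| ≤ T (ε • d) := by
      have := map_mono_of_map_sup hsup hwg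
      rwa [map_abs_of_map_sup hsup, map_sub, hTw, zero_sub, abs_neg] at this
    have hgd := abs_le_of_abs_map_le hsup h.injective hg
      (SMulMemClass.smul_mem ε (h.subset d hd)) hTg
    have := (abs_add_le (w - g) g).trans (add_le_add hwg hgd)
    rwa [sub_add_cancel, ← two_smul ℝ, smul_comm] at this

/-- An injective extension that is maximal is uniformly closed, and there is one. -/
theorem exists_uniformlyClosed_injectiveExtension {D : VectorSublattice E}
    (hsup : ∀ a b, T (a ⊔ b) = T a ⊔ T b) (hD : ∀ d ∈ D, T d = 0 → d = 0) :
    ∃ G, InjectiveExtension T D G ∧ G.UniformlyClosed := by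
  have hDD : InjectiveExtension T D D :=
    ⟨fun _ hd => hd, fun g hg => ⟨|g|, abs_mem hg, le_rfl⟩, hD⟩
  obtain ⟨_, -, ⟨G, hG, rfl⟩, hmax⟩ := zorn_subset_nonempty
    {s : Set E | ∃ G, InjectiveExtension T D G ∧ (G : Set E) = s} (fun c hcS hc hne => by
      obtain ⟨s₀, hs₀⟩ := hne
      -- Zorn's lemma is applied to carrier sets under inclusion; `c'` recovers the chain of
      -- sublattices behind them.
      let c' : Set (VectorSublattice E) := {G | InjectiveExtension T D G ∧ (G : Set E) ∈ c}
      have hc' : ∀ G ∈ c', ∀ G' ∈ c', (∀ g ∈ G, g ∈ G') ∨ ∀ g ∈ G', g ∈ G :=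
        fun G hG G' hG' => hc.total hG.2 hG'.2
      obtain ⟨G₀, hG₀, rfl⟩ := hcS hs₀
      have hne : c'.Nonempty := ⟨G₀, hG₀, hs₀⟩
      refine ⟨_, ⟨unionOfChain c' hne hc', ⟨?_, ?_, ?_⟩, rfl⟩, ?_⟩
      · exact fun d hd => ⟨G₀, ⟨hG₀, hs₀⟩, hG₀.subset d hd⟩
      · rintro g ⟨G, hG, hg⟩
        exact hG.1.majorized g hg
      · rintro g ⟨G, hG, hg⟩
        exact hG.1.injective g hg
      · intro s hs g hg
        obtain ⟨G, hG, rfl⟩ := hcS hs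
        exact ⟨G, ⟨hG, hs⟩, hg⟩) D ⟨D, hDD, rfl⟩
  refine ⟨G, hG, fun w d hd h => ?_⟩
  -- By maximality the adherence of `G` is contained in `G`, so it suffices to put `w` in the
  -- adherence. Its regulator `d` in `G` is replaced by a majorant in `D`.
  refine hmax ⟨_, hG.uniformAdherence hsup, rfl⟩ (fun g => mem_uniformAdherence_of_mem) ?_
  obtain ⟨d', hd', hdd⟩ := hG.majorized d hd
  refine ⟨d', hd', fun ε hε => ?_⟩
  obtain ⟨g, hg, hwg⟩ := h ε hε
  exact ⟨g, hg, hwg.trans (smul_le_smul_of_nonneg_left ((le_abs_self d).trans hdd) hε.le)⟩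

/-- A lattice homomorphism that is injective on `D` is injective on its uniformly complete hull. -/
theorem eq_zero_of_mem_uniformlyCompleteHull (hE : UniformlyComplete E) {D : VectorSublattice E}
    (hsup : ∀ a b, T (a ⊔ b) = T a ⊔ T b) (hD : ∀ d ∈ D, T d = 0 → d = 0) :
    ∀ w ∈ D.uniformlyCompleteHull, T w = 0 → w = 0 := by
  obtain ⟨G, hG, hGc⟩ := exists_uniformlyClosed_injectiveExtension hsup hD
  exact fun w hw => hG.injective w ((mem_uniformlyCompleteHull_iff hE).1 hw G hG.subset hGc)

/-- Approximants `T (g n)` of `w` satisfy Cauchy estimates relative to `T d`. Order reflection on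
`Y` transfers these to `g n` and `d`, completeness of `Y` gives a limit `l`, and `T l = w` by
uniqueness. -/
theorem UniformlyClosed.map [ArchimedeanVectorLattice F] (hE : UniformlyComplete E)
    {Y : VectorSublattice E} (hY : Y.UniformlyClosed)
    (hsup : ∀ a b, T (a ⊔ b) = T a ⊔ T b) (hinf : ∀ a b, T (a ⊓ b) = T a ⊓ T b)
    (hinj : ∀ w ∈ Y, T w = 0 → w = 0) : (Y.map hsup hinf).UniformlyClosed := by
  rintro w _ ⟨d, hd, rfl⟩ h
  have h' : ∀ n : ℕ, ∃ g ∈ Y, |w - T g| ≤ (n + 1 : ℝ)⁻¹ • T d := fun n => by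
    obtain ⟨_, ⟨g, hg, rfl⟩, hwg⟩ := h (n + 1 : ℝ)⁻¹ (by positivity)
    exact ⟨g, hg, hwg⟩
  choose g hgY hg using h'
  obtain ⟨l, hl⟩ := (hY.uniformlyComplete hE).exists_seq_limit
    (g := fun n => ⟨g n, hgY n⟩) (e := ⟨d, hd⟩) fun m n => by
      refine abs_le_of_abs_map_le hsup hinj (sub_mem (hgY m) (hgY n))
        (SMulMemClass.smul_mem _ hd) ?_
      change |T (g m - g n)| ≤ T (((m + 1 : ℝ)⁻¹ + (n + 1 : ℝ)⁻¹) • d)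
      rw [map_sub, map_smul]
      exact abs_sub_le_of_approx hg m n
  refine ⟨l, l.2, (eq_of_approx hg fun ε hε => ?_).symm⟩
  obtain ⟨N, hN⟩ := hl ε hε
  refine ⟨N, fun n hn => ?_⟩
  rw [← map_sub, ← map_abs_of_map_sup hsup, ← map_smul]
  exact map_mono_of_map_sup hsup (hN n hn)

/-- A lattice homomorphism between uniformly complete vector lattices that maps `D` bijectively
onto `X` maps the hull of `D` isomorphically onto the hull of `X`. -/
theorem exists_hull_equiv [ArchimedeanVectorLattice F] (hE : UniformlyComplete E)
    (hF : UniformlyComplete F) (hsup : ∀ a b, T (a ⊔ b) = T a ⊔ T b)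
    (hinf : ∀ a b, T (a ⊓ b) = T a ⊓ T b)
    {D : VectorSublattice E} {X : VectorSublattice F} (hX : ∀ x, x ∈ X ↔ ∃ d ∈ D, T d = x)
    (hD : ∀ d ∈ D, T d = 0 → d = 0) :
    ∃ e : D.uniformlyCompleteHull ≃ₗ[ℝ] X.uniformlyCompleteHull, ∀ w, (e w : F) = T w := by
  have hinj := eq_zero_of_mem_uniformlyCompleteHull hE hsup hD
  -- The preimage of the hull of `X` is a closed sublattice containing `D`, so it contains the hull
  -- of `D`.
  have hmaps : ∀ w ∈ D.uniformlyCompleteHull, T w ∈ X.uniformlyCompleteHull := fun w hw => by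
    refine (mem_uniformlyCompleteHull_iff hE).1 hw (X.uniformlyCompleteHull.comap hsup hinf) ?_
      ((uniformlyClosed_uniformlyCompleteHull hF X).comap hsup hinf)
    exact fun d hd => mem_uniformlyCompleteHull_of_mem ((hX _).2 ⟨d, hd, rfl⟩)
  -- Dually, the image of the hull of `D` is a closed sublattice containing `X`; this is where
  -- injectivity on the whole hull is needed.
  have hsurj : ∀ z ∈ X.uniformlyCompleteHull, ∃ w ∈ D.uniformlyCompleteHull, T w = z := by
    intro z hz
    refine (mem_uniformlyCompleteHull_iff hF).1 hz (D.uniformlyCompleteHull.map hsup hinf) ?_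
      ((uniformlyClosed_uniformlyCompleteHull hE D).map hE hsup hinf hinj)
    intro x hx
    obtain ⟨d, hd, rfl⟩ := (hX x).1 hx
    exact ⟨d, mem_uniformlyCompleteHull_of_mem hd, rfl⟩
  let f : D.uniformlyCompleteHull →ₗ[ℝ] X.uniformlyCompleteHull :=
    { toFun := fun w => ⟨T w, hmaps w w.2⟩
      map_add' := fun a b => Subtype.ext (map_add T (a : E) b)
      map_smul' := fun r a => Subtype.ext (map_smul T r (a : E)) }
  refine ⟨LinearEquiv.ofBijective f ⟨?_, ?_⟩, fun w => rfl⟩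
  · refine (injective_iff_map_eq_zero f).2 fun w hw => Subtype.ext ?_
    exact hinj w w.2 (congrArg Subtype.val hw)
  · rintro ⟨z, hz⟩
    obtain ⟨w, hw, rfl⟩ := hsurj z hz
    exact ⟨⟨w, hw⟩, rfl⟩

end Hom

end VectorSublattice

/-! ### Products and order completions are uniformly complete -/

section Prod

variable {E F : Type u} [AddCommGroup E] [Lattice E] [Module ℝ E] [ArchimedeanVectorLattice E]
  [AddCommGroup F] [Lattice F] [Module ℝ F] [ArchimedeanVectorLattice F]

instance : ArchimedeanVectorLattice (E × F) where
  add_le_add_left _ _ h c := ⟨add_le_add_left h.1 c.1, add_le_add_left h.2 c.2⟩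
  smul_le_smul_of_nonneg_left _ hr _ _ h :=
    ⟨smul_le_smul_of_nonneg_left h.1 hr, smul_le_smul_of_nonneg_left h.2 hr⟩
  smul_le_smul_of_nonneg_right _ ha _ _ h :=
    ⟨smul_le_smul_of_nonneg_right h ha.1, smul_le_smul_of_nonneg_right h ha.2⟩
  le_zero_of_nsmul_le x y h :=
    ⟨ArchimedeanVectorLattice.le_zero_of_nsmul_le x.1 y.1 fun n => (h n).1,
      ArchimedeanVectorLattice.le_zero_of_nsmul_le x.2 y.2 fun n => (h n).2⟩

/-- The coordinate limits may come with unrelated regulators, but both convergences hold relative to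
the coordinates of the Cauchy regulator `e`. -/
theorem UniformlyComplete.prod (hE : UniformlyComplete E) (hF : UniformlyComplete F) :
    UniformlyComplete (E × F) := by
  intro Λ _ _ _ x ⟨e, he, hx⟩
  have h1 : UniformlyConvergesRel e.1 (fun p : Λ × Λ => (x p.1).1 - (x p.2).1) 0 :=
    fun ε hε => (hx ε hε).imp fun _ h p hp => (h p hp).1
  have h2 : UniformlyConvergesRel e.2 (fun p : Λ × Λ => (x p.1).2 - (x p.2).2) 0 :=
    fun ε hε => (hx ε hε).imp fun _ h p hp => (h p hp).2
  obtain ⟨a, ha⟩ := hE Λ (fun α => (x α).1) ⟨e.1, he.1, h1⟩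
  obtain ⟨b, hb⟩ := hF Λ (fun α => (x α).2) ⟨e.2, he.2, h2⟩
  refine ⟨(a, b), e, he, fun ε hε => ?_⟩
  obtain ⟨α, hα⟩ := ha.rel_of_cauchy h1 ε hε
  obtain ⟨β, hβ⟩ := hb.rel_of_cauchy h2 ε hε
  obtain ⟨γ, hαγ, hβγ⟩ := exists_ge_ge α β
  exact ⟨γ, fun δ hδ => ⟨hα δ (hαγ.trans hδ), hβ δ (hβγ.trans hδ)⟩⟩

end Prod

/-- An order complete vector lattice is uniformly complete: the limit of a uniformly Cauchy net is
the supremum of its eventual lower bounds. -/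
theorem uniformlyComplete_of_exists_isLUB {E : Type u} [AddCommGroup E] [Lattice E] [Module ℝ E]
    [ArchimedeanVectorLattice E]
    (hE : ∀ S : Set E, S.Nonempty → BddAbove S → ∃ b, IsLUB S b) : UniformlyComplete E := by
  intro Λ _ _ _ x ⟨e, he, hx⟩
  have hx' : ∀ ε : ℝ, 0 < ε → ∃ α₀, ∀ α, α₀ ≤ α → ∀ β, α₀ ≤ β → x α ≤ x β + ε • e := by
    intro ε hε
    obtain ⟨⟨α₁, β₁⟩, h⟩ := hx ε hε
    obtain ⟨γ, hαγ, hβγ⟩ := exists_ge_ge α₁ β₁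
    refine ⟨γ, fun α hα β hβ => sub_le_iff_le_add'.1 ((le_abs_self _).trans ?_)⟩
    simpa using h (α, β) ⟨hαγ.trans hα, hβγ.trans hβ⟩
  let S : Set E := {a | ∃ α₀, ∀ α, α₀ ≤ α → a ≤ x α}
  -- Far terms nearly attain `sup S`: `x α - ε • e` belongs to `S`, while `x α + ε • e` bounds `S`
  -- from above.
  have hlow : ∀ ε : ℝ, 0 < ε → ∃ α₀, ∀ α, α₀ ≤ α →
      x α - ε • e ∈ S ∧ ∀ a ∈ S, a ≤ x α + ε • e := by
    intro ε hε
    obtain ⟨α₀, h⟩ := hx' ε hε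
    refine ⟨α₀, fun α hα => ⟨⟨α₀, fun β hβ => sub_le_iff_le_add.2 (h α hα β hβ)⟩, ?_⟩⟩
    rintro a ⟨β₀, ha⟩
    obtain ⟨γ, hαγ, hβγ⟩ := exists_ge_ge α₀ β₀
    exact (ha γ hβγ).trans (h γ hαγ α hα)
  obtain ⟨α₁, h₁⟩ := hlow 1 one_pos
  obtain ⟨l, hl⟩ := hE S ⟨_, (h₁ α₁ le_rfl).1⟩ ⟨_, (h₁ α₁ le_rfl).2⟩
  refine ⟨l, e, he, fun ε hε => ?_⟩
  obtain ⟨α₀, h₀⟩ := hlow ε hε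
  refine ⟨α₀, fun α hα => abs_le'.2 ⟨?_, ?_⟩⟩
  · exact sub_le_comm.1 (hl.1 (h₀ α hα).1)
  · rw [neg_sub]
    exact sub_le_iff_le_add'.2 (hl.2 (h₀ α hα).2)

/-- The copy `{(of x, x)}` of a sublattice in the product of its order completion with the ambient
vector lattice. -/
def VectorSublattice.diagonal {Z : Type u} [AddCommGroup Z] [Lattice Z] [Module ℝ Z]
    [ArchimedeanVectorLattice Z] (X : VectorSublattice Z) :
    VectorSublattice (OrderCompletion X × Z) where
  toSubmodule := LinearMap.range
    ((OrderCompletion.ofLinear (E := X)).prod X.toSubmodule.subtype)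
  sup_mem' := by
    rintro _ _ ⟨x, rfl⟩ ⟨y, rfl⟩
    exact ⟨x ⊔ y, Prod.ext (OrderCompletion.of_sup x y) rfl⟩
  inf_mem' := by
    rintro _ _ ⟨x, rfl⟩ ⟨y, rfl⟩
    exact ⟨x ⊓ y, Prod.ext (OrderCompletion.of_inf x y) rfl⟩

/-! ### The two projections of the hull of the diagonal -/

theorem mainTheorem2 {Z : Type u} [AddCommGroup Z] [Lattice Z] [Module ℝ Z]
    [ArchimedeanVectorLattice Z] (hZ : UniformlyComplete Z) (X : VectorSublattice Z) :
    ∃ e : uniformCompletion X ≃ₗ[ℝ] X.uniformlyCompleteHull,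
      (∀ a b, e (a ⊔ b) = e a ⊔ e b) ∧ (∀ a b, e (a ⊓ b) = e a ⊓ e b) ∧
        ∀ x : X, ((e (toUniformCompletion x) : X.uniformlyCompleteHull) : Z) = x := by
  have hC : UniformlyComplete (OrderCompletion X) :=
    uniformlyComplete_of_exists_isLUB OrderCompletion.exists_isLUB
  have hW := hC.prod hZ
  obtain ⟨f, hf⟩ : ∃ f : X.diagonal.uniformlyCompleteHull ≃ₗ[ℝ] uniformCompletion X,
      ∀ w, (f w : OrderCompletion X) = LinearMap.fst ℝ (OrderCompletion X) Z w :=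
    VectorSublattice.exists_hull_equiv
    (D := X.diagonal) (X := OrderCompletion.base X) hW hC (fun _ _ => rfl) (fun _ _ => rfl)
    (fun a => ⟨fun ⟨x, hx⟩ => ⟨_, ⟨x, rfl⟩, hx⟩, fun ⟨_, ⟨x, hx⟩, h⟩ => by
      subst hx h
      exact ⟨x, rfl⟩⟩)
    (by
      rintro _ ⟨x, rfl⟩ hx
      obtain rfl : x = 0 := OrderCompletion.of_injective hx
      exact map_zero _)
  obtain ⟨g, hg⟩ := VectorSublattice.exists_hull_equiv (T := LinearMap.snd ℝ (OrderCompletion X) Z)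
    (D := X.diagonal) (X := X) hW hZ (fun _ _ => rfl) (fun _ _ => rfl)
    (fun z => ⟨fun hz => ⟨_, ⟨⟨z, hz⟩, rfl⟩, rfl⟩, fun ⟨_, ⟨x, hx⟩, h⟩ => by
      subst hx h
      exact x.2⟩)
    (by
      rintro _ ⟨x, rfl⟩ hx
      obtain rfl : x = 0 := Subtype.ext hx
      exact map_zero _)
  -- The equivalences inherit the lattice operations because they are restrictions of coordinate
  -- projections.
  have hfsup : ∀ a b, f (a ⊔ b) = f a ⊔ f b := fun a b => Subtype.ext (by
    rw [hf]; exact (congrArg₂ (· ⊔ ·) (hf a) (hf b)).symm)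
  have hfinf : ∀ a b, f (a ⊓ b) = f a ⊓ f b := fun a b => Subtype.ext (by
    rw [hf]; exact (congrArg₂ (· ⊓ ·) (hf a) (hf b)).symm)
  have hgsup : ∀ a b, g (a ⊔ b) = g a ⊔ g b := fun a b => Subtype.ext (by
    rw [hg]; exact (congrArg₂ (· ⊔ ·) (hg a) (hg b)).symm)
  have hginf : ∀ a b, g (a ⊓ b) = g a ⊓ g b := fun a b => Subtype.ext (by
    rw [hg]; exact (congrArg₂ (· ⊓ ·) (hg a) (hg b)).symm)
  refine ⟨f.symm.trans g, fun a b => ?_, fun a b => ?_, fun x => ?_⟩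
  · obtain ⟨a, rfl⟩ := f.surjective a
    obtain ⟨b, rfl⟩ := f.surjective b
    rw [← hfsup]
    simp [hgsup]
  · obtain ⟨a, rfl⟩ := f.surjective a
    obtain ⟨b, rfl⟩ := f.surjective b
    rw [← hfinf]
    simp [hginf]
  · let d : X.diagonal.uniformlyCompleteHull :=
      ⟨(OrderCompletion.of x, x), VectorSublattice.mem_uniformlyCompleteHull_of_mem ⟨x, rfl⟩⟩
    have hd : toUniformCompletion x = f d := Subtype.ext (hf d).symm
    rw [hd, LinearEquiv.trans_apply, LinearEquiv.symm_apply_apply, hg]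
    rfl
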